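/- For integers $k,n\ge 0$ let $\mathrm{DIV}_k(n)$ be the condition $k!\mid\binom nk$, and let $\mathrm{ALLDIV}_k(n)$ be the conjunction $\mathrm{DIV}_1(n)\wedge\cdots\wedge\mathrm{DIV}_k(n)$. Let $T(k)$ be the least positive integer $m$ such that the truth of $\mathrm{ALLDIV}_k(n)$ depends only on the congruence class of $n$ modulo $m$, and let $D(k)$ be the least positive integer $m$ such that the truth of the single condition $\mathrm{DIV}_k(n)$ depends only on the congruence class of $n$ modulo $m$. For a prime $p$ let $\nu_p$ be the $p$-adic valuation, with $\nu_p(0)=\infty$, put $e_p(k)=\nu_p(k!)$ and $f_{p,k}(n)=\sum_{j=0}^{k-1}\nu_p(n-j)$, and let $a_p(k)$ be the least $m\ge 0$ such that the truth of $f_{p,k}(n)\ge 2e_p(k)$ depends only on the congruence class of $n$ modulo $p^m$ (so $a_p(k)=0$ for $p>k$). Then, for every $k\ge 0$, $$\log D(k)=\sum_{p}a_p(k)\log p ,$$ and, as $k\to\infty$, $$\log D(k)=\sum_{p}a_p(k)\log p=k\log k+O(k)\qquad\text{and}\qquad \log T(k)=k\log k+O(k).$$ -/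

import Mathlib

open Filter Asymptotics

/-- `DIV_k(n)`: the number `binom(n,k)/k!` is an integer. -/
def DivCond (k n : ℕ) : Prop := k.factorial ∣ n.choose k

/-- `ALLDIV_k(n)`: the conditions `DIV_1(n), …, DIV_k(n)` all hold. -/
def AllDivCond (k n : ℕ) : Prop := ∀ i, 1 ≤ i → i ≤ k → DivCond i n

/-- Whether `P n` holds depends only on the congruence class of `n` modulo `m`. -/
def DependsOnlyOnClass (P : ℕ → Prop) (m : ℕ) : Prop :=
  ∀ n n' : ℕ, n ≡ n' [MOD m] → (P n ↔ P n')

/-- The least positive modulus `m` such that `P n` depends only on `n` modulo `m`. -/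
noncomputable def minModulus (P : ℕ → Prop) : ℕ :=
  sInf {m : ℕ | 0 < m ∧ DependsOnlyOnClass P m}

/-- `e_p(k)`: the exponent of `p` in the factorization of `k!`. -/
def eExp (p k : ℕ) : ℕ := k.factorial.factorization p

/-- `f_{p,k}(n) = ∑_{j<k} ν_p(n-j)`, with `ν_p(0) = ∞`. -/
noncomputable def fVal (p k n : ℕ) : ℕ∞ :=
  ∑ j ∈ Finset.range k, emultiplicity (p : ℤ) ((n : ℤ) - (j : ℤ))

/-- The condition `f_{p,k}(n) ≥ 2 e_p(k)`. -/
def PrimeCond (p k n : ℕ) : Prop := ((2 * eExp p k : ℕ) : ℕ∞) ≤ fVal p k n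

/-- `a_p(k)`: the least `m` such that `f_{p,k}(n) ≥ 2 e_p(k)` depends only on `n` modulo `p^m`. -/
noncomputable def aExp (p k : ℕ) : ℕ :=
  sInf {m : ℕ | DependsOnlyOnClass (PrimeCond p k) (p ^ m)}

/-- `T(k)`: the minimal modulus for the condition `ALLDIV_k`. -/
noncomputable def minModulusAllDiv (k : ℕ) : ℕ := minModulus (AllDivCond k)

/-- `D(k)`: the minimal modulus for the single condition `DIV_k`. -/
noncomputable def minModulusDiv (k : ℕ) : ℕ := minModulus (DivCond k)

/-- `∑_p a_p(k) log p`, the sum being over the primes `p ≤ k`; the other primes have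
`a_p(k) = 0`, see `aExp_eq_zero_of_lt`. -/
noncomputable def sumAExpLog (k : ℕ) : ℝ :=
  ∑ p ∈ (Finset.range (k + 1)).filter Nat.Prime, (aExp p k : ℝ) * Real.log (p : ℝ)

theorem aExp_eq_zero_of_lt {p k : ℕ} (h : k < p) : aExp p k = 0 := by
  have he : eExp p k = 0 := Nat.factorization_factorial_eq_zero_of_lt h
  refine Nat.sInf_eq_zero.2 (Or.inl ?_)
  intro n n' _
  simp [PrimeCond, he]

/-! The minima in the definitions above are attained. -/

theorem divCond_iff (k n : ℕ) :
    DivCond k n ↔ ((k.factorial ^ 2 : ℕ) : ℤ) ∣ ∏ j ∈ Finset.range k, ((n : ℤ) - (j : ℤ)) := by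
  have h : ∏ j ∈ Finset.range k, ((n : ℤ) - (j : ℤ)) = ((n.descFactorial k : ℕ) : ℤ) := by
    rw [← descPochhammer_eval_eq_descFactorial ℤ n k, descPochhammer_eval_eq_prod_range]
  rw [h, Int.natCast_dvd_natCast, Nat.descFactorial_eq_factorial_mul_choose, sq, DivCond,
    Nat.mul_dvd_mul_iff_left (Nat.factorial_pos k)]

theorem prod_sub_modEq {m k n n' : ℕ} (h : n ≡ n' [MOD m]) :
    (∏ j ∈ Finset.range k, ((n : ℤ) - (j : ℤ))) ≡
      ∏ j ∈ Finset.range k, ((n' : ℤ) - (j : ℤ)) [ZMOD (m : ℤ)] := by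
  have h' : (n : ℤ) ≡ n' [ZMOD (m : ℤ)] := (Int.natCast_modEq_iff).2 h
  induction k with
  | zero => simp [Int.ModEq.refl]
  | succ k ih =>
    rw [Finset.prod_range_succ, Finset.prod_range_succ]
    exact ih.mul (h'.sub_right _)

theorem dependsOnlyOnClass_divCond (k : ℕ) :
    DependsOnlyOnClass (DivCond k) (k.factorial ^ 2) := by
  intro n n' h
  rw [divCond_iff, divCond_iff]
  exact (prod_sub_modEq h).dvd_iff

theorem dependsOnlyOnClass_allDivCond (k : ℕ) :
    DependsOnlyOnClass (AllDivCond k) (k.factorial ^ 2) := by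
  intro n n' h
  refine forall_congr' fun i => forall_congr' fun _ => forall_congr' fun hi => ?_
  exact dependsOnlyOnClass_divCond i n n'
    (h.of_dvd (pow_dvd_pow_of_dvd (Nat.factorial_dvd_factorial hi) 2))

theorem minModulusDiv_isLeast (k : ℕ) :
    IsLeast {m : ℕ | 0 < m ∧ DependsOnlyOnClass (DivCond k) m} (minModulusDiv k) :=
  ⟨Nat.sInf_mem ⟨_, pow_pos (Nat.factorial_pos k) 2, dependsOnlyOnClass_divCond k⟩,
    fun _ hm => Nat.sInf_le hm⟩

theorem minModulusAllDiv_isLeast (k : ℕ) :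
    IsLeast {m : ℕ | 0 < m ∧ DependsOnlyOnClass (AllDivCond k) m} (minModulusAllDiv k) :=
  ⟨Nat.sInf_mem ⟨_, pow_pos (Nat.factorial_pos k) 2, dependsOnlyOnClass_allDivCond k⟩,
    fun _ hm => Nat.sInf_le hm⟩

theorem aExp_isLeast {p : ℕ} (hp : p.Prime) (k : ℕ) :
    IsLeast {m : ℕ | DependsOnlyOnClass (PrimeCond p k) (p ^ m)} (aExp p k) := by
  refine ⟨Nat.sInf_mem ⟨2 * eExp p k, ?_⟩, fun _ hm => Nat.sInf_le hm⟩
  have key : ∀ n, PrimeCond p k n ↔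
      ((p ^ (2 * eExp p k) : ℕ) : ℤ) ∣ ∏ j ∈ Finset.range k, ((n : ℤ) - (j : ℤ)) := by
    intro n
    rw [PrimeCond, fVal, ← Finset.emultiplicity_prod (Nat.prime_iff_prime_int.1 hp),
      Nat.cast_pow, pow_dvd_iff_le_emultiplicity]
  intro n n' h
  rw [key, key]
  exact (prod_sub_modEq h).dvd_iff

/-! ### The conditions in terms of binomial coefficients -/

/-! Let `L = lcm(1, …, k)`. Both minimal moduli `X` satisfy `X ≤ k! L` and `k! ∣ X L ^ 2`; since
`log L = ψ(k) = O(k)` and `log k! = k log k + O(k)`, the asymptotics follow. Upper bound: by Kummer,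
`ν_p` of `binom(n, k)` counts the `i` with `n % p ^ i < k % p ^ i`, and from this `p ^ (e_p(k) +
log_p k)` is a valid modulus (`dependsOnlyOnClass_primeCond`). Lower bound: `0` satisfies every
condition, hence so does every multiple of a valid modulus, while a suitable multiple has few
carries (`factorization_choose_le_of_le_pow`). The exact formula for `D(k)` is the Chinese remainder
theorem, with `0` as a residue making all other prime conditions true (`aExp_le_factorization`). -/

theorem primeCond_iff {p : ℕ} (hp : p.Prime) (k n : ℕ) :
    PrimeCond p k n ↔ p ^ eExp p k ∣ n.choose k := by
  have h : ∏ j ∈ Finset.range k, ((n : ℤ) - (j : ℤ)) = ((n.descFactorial k : ℕ) : ℤ) := by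
    rw [← descPochhammer_eval_eq_descFactorial ℤ n k, descPochhammer_eval_eq_prod_range]
  rw [PrimeCond, fVal, ← Finset.emultiplicity_prod (Nat.prime_iff_prime_int.1 hp),
    ← pow_dvd_iff_le_emultiplicity, h, ← Nat.cast_pow, Int.natCast_dvd_natCast,
    Nat.descFactorial_eq_factorial_mul_choose, two_mul, pow_add]
  have hc : p ^ eExp p k * (k.factorial / p ^ eExp p k) = k.factorial :=
    Nat.ordProj_mul_ordCompl_eq_self _ _
  have hco : Nat.Coprime (p ^ eExp p k) (k.factorial / p ^ eExp p k) :=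
    (Nat.coprime_ordCompl hp k.factorial_ne_zero).pow_left _
  rw [← hc, mul_assoc (p ^ eExp p k), Nat.mul_dvd_mul_iff_left (pow_pos hp.pos _)]
  exact hco.dvd_mul_left

theorem divCond_iff_forall_primeCond (k n : ℕ) :
    DivCond k n ↔ ∀ p, p.Prime → PrimeCond p k n := by
  constructor
  · intro h p hp
    exact (primeCond_iff hp k n).2 ((Nat.ordProj_dvd _ _).trans h)
  · intro h
    rcases eq_or_ne (n.choose k) 0 with h0 | h0
    · simp [DivCond, h0]
    · rw [DivCond, ← Nat.factorization_prime_le_iff_dvd k.factorial_ne_zero h0]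
      intro p hp
      exact (hp.pow_dvd_iff_le_factorization h0).1 ((primeCond_iff hp k n).1 (h p hp))

theorem primeCond_of_lt {p k n : ℕ} (hp : p.Prime) (h : n < k) : PrimeCond p k n := by
  rw [primeCond_iff hp, Nat.choose_eq_zero_of_lt h]
  exact dvd_zero _

theorem primeCond_of_prime_gt {p k : ℕ} (h : k < p) (n : ℕ) : PrimeCond p k n := by
  have he : eExp p k = 0 := Nat.factorization_factorial_eq_zero_of_lt h
  simp [PrimeCond, he]

theorem primeCond_zero {p : ℕ} (hp : p.Prime) (k : ℕ) : PrimeCond p k 0 := by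
  rcases Nat.eq_zero_or_pos k with rfl | hk
  · exact primeCond_of_prime_gt hp.pos 0
  · exact primeCond_of_lt hp hk

theorem divCond_zero (k : ℕ) : DivCond k 0 :=
  (divCond_iff_forall_primeCond k 0).2 fun _ hp => primeCond_zero hp k

/-! ### Counting carries -/

/-- A sum of two residues overflows `q` exactly when its own residue drops below a summand. -/
theorem carry_iff {q k n : ℕ} (hq : 0 < q) (h : k ≤ n) :
    q ≤ k % q + (n - k) % q ↔ n % q < k % q := by
  have h1 : n % q = (k % q + (n - k) % q) % q := by
    rw [← Nat.add_mod, Nat.add_sub_cancel' h]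
  have hk := Nat.mod_lt k hq
  have hn := Nat.mod_lt (n - k) hq
  rcases le_or_gt q (k % q + (n - k) % q) with hc | hc
  · rw [Nat.mod_eq_sub_mod hc,
      Nat.mod_eq_of_lt (a := k % q + (n - k) % q - q) (Nat.sub_lt_left_of_lt_add hc
        (Nat.add_lt_add hk hn))] at h1
    omega
  · rw [Nat.mod_eq_of_lt hc] at h1
    omega

theorem factorization_choose_eq_card_mod_lt {p n k b : ℕ} (hp : p.Prime) (hkn : k ≤ n)
    (hb : Nat.log p n < b) :
    (n.choose k).factorization p
      = ((Finset.Ico 1 b).filter fun i => n % p ^ i < k % p ^ i).card := by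
  rw [Nat.factorization_choose hp hkn hb]
  congr 1
  exact Finset.filter_congr fun i _ => carry_iff (pow_pos hp.pos i) hkn

theorem primeCond_iff_le_factorization {p k n : ℕ} (hp : p.Prime) (h : k ≤ n) :
    PrimeCond p k n ↔ eExp p k ≤ (n.choose k).factorization p := by
  rw [primeCond_iff hp, hp.pow_dvd_iff_le_factorization (Nat.choose_pos h).ne']

/-- Every position `i` with `log_p k < i ≤ m` carries, as there `k % p ^ i = k` and `n % p ^ i ≤ n %
p ^ m < k`; these are at least `e_p(k)` positions. -/
theorem primeCond_of_mod_lt {p k n m : ℕ} (hp : p.Prime) (hm : eExp p k + Nat.log p k ≤ m)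
    (hr : n % p ^ m < k) : PrimeCond p k n := by
  rcases lt_or_ge n k with h | h
  · exact primeCond_of_lt hp h
  rw [primeCond_iff_le_factorization hp h,
    factorization_choose_eq_card_mod_lt (b := Nat.log p n + m + 1) hp h (by omega)]
  have hsub : Finset.Ioc (Nat.log p k) m ⊆
      (Finset.Ico 1 (Nat.log p n + m + 1)).filter fun i => n % p ^ i < k % p ^ i := by
    intro i hi
    rw [Finset.mem_Ioc] at hi
    rw [Finset.mem_filter, Finset.mem_Ico]
    refine ⟨⟨by omega, by omega⟩, ?_⟩
    rw [Nat.mod_eq_of_lt (Nat.lt_pow_of_log_lt hp.one_lt hi.1),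
      ← Nat.mod_mod_of_dvd n (pow_dvd_pow p hi.2)]
    exact (Nat.mod_le _ _).trans_lt hr
  have := Finset.card_le_card hsub
  rw [Nat.card_Ioc] at this
  omega

/-- If the residue mod `p ^ m` is below `k`, the condition holds outright. Otherwise no position `i
≥ m` carries, so the residue determines all carries. -/
theorem dependsOnlyOnClass_primeCond {p k m : ℕ} (hp : p.Prime)
    (hm : eExp p k + Nat.log p k ≤ m) : DependsOnlyOnClass (PrimeCond p k) (p ^ m) := by
  intro n n' h
  rcases lt_or_ge (n % p ^ m) k with hr | hr
  · exact iff_of_true (primeCond_of_mod_lt hp hm hr) (primeCond_of_mod_lt hp hm (h ▸ hr))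
  have hr' : k ≤ n' % p ^ m := h ▸ hr
  have hn : k ≤ n := hr.trans (Nat.mod_le _ _)
  have hn' : k ≤ n' := hr'.trans (Nat.mod_le _ _)
  rw [primeCond_iff_le_factorization hp hn, primeCond_iff_le_factorization hp hn',
    factorization_choose_eq_card_mod_lt (b := Nat.log p n + Nat.log p n' + 1) hp hn (by omega),
    factorization_choose_eq_card_mod_lt (b := Nat.log p n + Nat.log p n' + 1) hp hn' (by omega)]
  have hno : ∀ {x i : ℕ}, k ≤ x % p ^ m → m ≤ i → ¬ x % p ^ i < k % p ^ i := by
    intro x i hx hi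
    have h1 : x % p ^ m ≤ x % p ^ i := by
      rw [← Nat.mod_mod_of_dvd x (pow_dvd_pow p hi)]
      exact Nat.mod_le _ _
    have := Nat.mod_le k (p ^ i)
    omega
  have : ((Finset.Ico 1 (Nat.log p n + Nat.log p n' + 1)).filter fun i => n % p ^ i < k % p ^ i)
      = (Finset.Ico 1 (Nat.log p n + Nat.log p n' + 1)).filter fun i => n' % p ^ i < k % p ^ i := by
    refine Finset.filter_congr fun i _ => ?_
    rcases le_total m i with hi | hi
    · exact iff_of_false (hno hr hi) (hno hr' hi)
    · rw [show n % p ^ i = n' % p ^ i from h.of_dvd (pow_dvd_pow p hi)]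
  rw [this]

/-- Beyond position `ν_p(n)`, the residue `n % p ^ i` is a nonzero multiple of `p ^ ν_p(n)`, hence
at least `k`, and there is no carry. -/
theorem factorization_choose_le_of_le_pow {p k n : ℕ} (hp : p.Prime) (hn : n ≠ 0)
    (hk : k ≤ p ^ n.factorization p) : (n.choose k).factorization p ≤ n.factorization p := by
  have hkn : k ≤ n := hk.trans (Nat.le_of_dvd (Nat.pos_of_ne_zero hn) (Nat.ordProj_dvd n p))
  rw [factorization_choose_eq_card_mod_lt hp hkn (Nat.lt_succ_self _)]
  refine (Finset.card_le_card (t := Finset.Ioc 0 (n.factorization p)) ?_).trans_eq (by simp)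
  intro i hi
  rw [Finset.mem_filter, Finset.mem_Ico] at hi
  rw [Finset.mem_Ioc]
  refine ⟨by omega, ?_⟩
  by_contra! hlt
  have hnd : ¬ p ^ i ∣ n := by
    rw [hp.pow_dvd_iff_le_factorization hn]
    omega
  have hpos : 0 < n % p ^ i := Nat.pos_of_ne_zero fun h => hnd (Nat.dvd_of_mod_eq_zero h)
  have hd : p ^ n.factorization p ∣ n % p ^ i :=
    (Nat.dvd_mod_iff (pow_dvd_pow p hlt.le)).2 (Nat.ordProj_dvd n p)
  have := Nat.le_of_dvd hpos hd
  have := Nat.mod_le k (p ^ i)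
  omega

/-! ### Valid moduli -/

theorem DependsOnlyOnClass.of_dvd {P : ℕ → Prop} {m m' : ℕ} (h : DependsOnlyOnClass P m)
    (hd : m ∣ m') : DependsOnlyOnClass P m' :=
  fun n n' hn => h n n' (hn.of_dvd hd)

theorem dependsOnlyOnClass_divCond_of_forall {k m : ℕ}
    (h : ∀ p, p.Prime → p ≤ k → DependsOnlyOnClass (PrimeCond p k) m) :
    DependsOnlyOnClass (DivCond k) m := by
  intro n n' hn
  rw [divCond_iff_forall_primeCond, divCond_iff_forall_primeCond]
  refine forall_congr' fun p => forall_congr' fun hp => ?_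
  rcases le_or_gt p k with hpk | hpk
  · exact h p hp hpk n n' hn
  · exact iff_of_true (primeCond_of_prime_gt hpk n) (primeCond_of_prime_gt hpk n')

theorem dependsOnlyOnClass_divCond_factorial_mul_lcmUpto {i k : ℕ} (h : i ≤ k) :
    DependsOnlyOnClass (DivCond i) (k.factorial * k.lcmUpto) := by
  refine dependsOnlyOnClass_divCond_of_forall fun p hp _ => ?_
  refine (dependsOnlyOnClass_primeCond hp le_rfl).of_dvd ?_
  rw [pow_add]
  refine mul_dvd_mul ((Nat.ordProj_dvd _ _).trans (Nat.factorial_dvd_factorial h)) ?_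
  rw [hp.pow_dvd_iff_le_factorization (Nat.lcmUpto_ne_zero k), Nat.factorization_lcmUpto k hp]
  exact Nat.log_mono_right h

theorem minModulusDiv_le (k : ℕ) : minModulusDiv k ≤ k.factorial * k.lcmUpto :=
  (minModulusDiv_isLeast k).2 ⟨Nat.mul_pos k.factorial_pos k.lcmUpto_pos,
    dependsOnlyOnClass_divCond_factorial_mul_lcmUpto le_rfl⟩

theorem minModulusAllDiv_le (k : ℕ) : minModulusAllDiv k ≤ k.factorial * k.lcmUpto := by
  refine (minModulusAllDiv_isLeast k).2 ⟨Nat.mul_pos k.factorial_pos k.lcmUpto_pos, ?_⟩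
  intro n n' h
  refine forall_congr' fun i => forall_congr' fun _ => forall_congr' fun hi => ?_
  exact dependsOnlyOnClass_divCond_factorial_mul_lcmUpto hi n n' h

/-- Test the multiple `M * p ^ (log_p k + 1)` of `M`: the extra factor makes its `p`-part at least
`k`, so the carry bound applies. A general `P` serves both `DivCond` and `AllDivCond`. -/
theorem eExp_le_of_dependsOnlyOnClass {P : ℕ → Prop} {p k M : ℕ} (hp : p.Prime) (h0 : P 0)
    (hP : ∀ n, P n → PrimeCond p k n) (hM : M ≠ 0) (h : DependsOnlyOnClass P M) :
    eExp p k ≤ M.factorization p + (Nat.log p k + 1) := by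
  have hs : p ^ (Nat.log p k + 1) ≠ 0 := pow_ne_zero _ hp.ne_zero
  have hfac : (M * p ^ (Nat.log p k + 1)).factorization p
      = M.factorization p + (Nat.log p k + 1) := by
    rw [Nat.factorization_mul hM hs, Finsupp.add_apply, hp.factorization_pow,
      Finsupp.single_eq_same]
  have hkp : k ≤ p ^ (M * p ^ (Nat.log p k + 1)).factorization p := by
    rw [hfac]
    exact (Nat.lt_pow_succ_log_self hp.one_lt k).le.trans
      (Nat.pow_le_pow_right hp.pos (Nat.le_add_left _ _))
  have hpos : M * p ^ (Nat.log p k + 1) ≠ 0 := mul_ne_zero hM hs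
  have hPn : P (M * p ^ (Nat.log p k + 1)) :=
    (h 0 _ ((Nat.modEq_zero_iff_dvd.2 (Dvd.intro _ rfl)).symm)).1 h0
  have hkn := hkp.trans (Nat.le_of_dvd (Nat.pos_of_ne_zero hpos) (Nat.ordProj_dvd _ p))
  have h1 := (primeCond_iff_le_factorization hp hkn).1 (hP _ hPn)
  exact hfac ▸ h1.trans (factorization_choose_le_of_le_pow hp hpos hkp)

theorem factorial_dvd_of_dependsOnlyOnClass {P : ℕ → Prop} {k M : ℕ} (h0 : P 0)
    (hP : ∀ n, P n → DivCond k n) (hM : M ≠ 0) (h : DependsOnlyOnClass P M) :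
    k.factorial ∣ M * k.lcmUpto ^ 2 := by
  have hl : k.lcmUpto ^ 2 ≠ 0 := pow_ne_zero _ k.lcmUpto_ne_zero
  rw [← Nat.factorization_prime_le_iff_dvd k.factorial_ne_zero (mul_ne_zero hM hl)]
  intro p hp
  rcases lt_or_ge k p with hpk | hpk
  · rw [Nat.factorization_factorial_eq_zero_of_lt hpk]
    exact Nat.zero_le _
  have h1 := eExp_le_of_dependsOnlyOnClass hp h0
    (fun n hn => (divCond_iff_forall_primeCond k n).1 (hP n hn) p hp) hM h
  -- For `p ≤ k` this gives `log_p k + 1 ≤ 2 log_p k`, which is why the square of the lcm suffices.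
  have hlog : 0 < Nat.log p k := Nat.log_pos hp.one_lt hpk
  rw [Nat.factorization_mul hM hl, Finsupp.add_apply, Nat.factorization_pow, Finsupp.smul_apply,
    Nat.factorization_lcmUpto k hp, smul_eq_mul]
  have h2 : eExp p k = k.factorial.factorization p := rfl
  omega

theorem factorial_dvd_minModulusDiv_mul (k : ℕ) :
    k.factorial ∣ minModulusDiv k * k.lcmUpto ^ 2 :=
  factorial_dvd_of_dependsOnlyOnClass (divCond_zero k) (fun _ h => h)
    (minModulusDiv_isLeast k).1.1.ne' (minModulusDiv_isLeast k).1.2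

theorem factorial_dvd_minModulusAllDiv_mul (k : ℕ) :
    k.factorial ∣ minModulusAllDiv k * k.lcmUpto ^ 2 := by
  refine factorial_dvd_of_dependsOnlyOnClass (P := AllDivCond k) (fun i _ _ => divCond_zero i) ?_
    (minModulusAllDiv_isLeast k).1.1.ne' (minModulusAllDiv_isLeast k).1.2
  intro n h
  rcases Nat.eq_zero_or_pos k with rfl | hk
  · simp [DivCond]
  · exact h k hk le_rfl

/-! ### The modulus of the single condition as a product of prime powers -/

theorem aExp_le_factorization {p k M : ℕ} (hp : p.Prime) (hM : M ≠ 0)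
    (h : DependsOnlyOnClass (DivCond k) M) : aExp p k ≤ M.factorization p := by
  refine (aExp_isLeast hp k).2 ?_
  intro n n' hnn
  have hN : k.factorial * k.lcmUpto ≠ 0 := mul_ne_zero k.factorial_ne_zero k.lcmUpto_ne_zero
  have hK : M * (k.factorial * k.lcmUpto) ≠ 0 := mul_ne_zero hM hN
  -- `K` is a multiple of `M` large enough that its `q`-part is a valid modulus for the condition at
  -- every prime `q`.
  set K := M * (k.factorial * k.lcmUpto) with hKdef
  have hco : Nat.Coprime (p ^ K.factorization p) (K / p ^ K.factorization p) :=
    (Nat.coprime_ordCompl hp hK).pow_left _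
  have hdep : ∀ q, q.Prime → DependsOnlyOnClass (PrimeCond q k) (q ^ K.factorization q) := by
    intro q hq
    refine dependsOnlyOnClass_primeCond hq ?_
    rw [hKdef, Nat.factorization_mul hM hN, Finsupp.add_apply,
      Nat.factorization_mul k.factorial_ne_zero k.lcmUpto_ne_zero, Finsupp.add_apply,
      Nat.factorization_lcmUpto k hq]
    exact Nat.le_add_left _ _
  have key : ∀ x y : ℕ, y ≡ x [MOD p ^ K.factorization p] →
      y ≡ 0 [MOD K / p ^ K.factorization p] → (DivCond k y ↔ PrimeCond p k x) := by
    intro x y hx hy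
    rw [← hdep p hp y x hx, divCond_iff_forall_primeCond]
    refine ⟨fun h => h p hp, fun h q hq => ?_⟩
    rcases eq_or_ne q p with rfl | hqp
    · exact h
    refine (hdep q hq y 0 (hy.of_dvd ?_)).2 (primeCond_zero hq k)
    refine Nat.Coprime.dvd_of_dvd_mul_left (m := p ^ K.factorization p)
      (((Nat.coprime_primes hq hp).2 hqp).pow _ _) ?_
    rw [Nat.ordProj_mul_ordCompl_eq_self]
    exact Nat.ordProj_dvd K q
  -- The lifts keep the residues of `n`, `n'` at `p` and are `0` away from `p`, so they are
  -- congruent mod `M` and only the condition at `p` can fail.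
  obtain ⟨y, hy1, hy2⟩ := Nat.chineseRemainder hco n 0
  obtain ⟨y', hy1', hy2'⟩ := Nat.chineseRemainder hco n' 0
  rw [← key n y hy1 hy2, ← key n' y' hy1' hy2']
  refine h y y' ?_
  have hMK : M ∣ K := Dvd.intro _ rfl
  have hle : p ^ M.factorization p ∣ p ^ K.factorization p :=
    pow_dvd_pow p ((Nat.factorization_le_iff_dvd hM hK).2 hMK p)
  have hcoM : Nat.Coprime (p ^ M.factorization p) (M / p ^ M.factorization p) :=
    (Nat.coprime_ordCompl hp hM).pow_left _
  rw [← Nat.ordProj_mul_ordCompl_eq_self M p, ← Nat.modEq_and_modEq_iff_modEq_mul hcoM]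
  exact ⟨((hy1.of_dvd hle).trans hnn).trans (hy1'.of_dvd hle).symm,
    (hy2.trans hy2'.symm).of_dvd (Nat.ordCompl_dvd_ordCompl_of_dvd hMK p)⟩

theorem minModulusDiv_eq_prod (k : ℕ) :
    minModulusDiv k = ∏ p ∈ (Finset.range (k + 1)).filter Nat.Prime, p ^ aExp p k := by
  have hmem : ∀ p ∈ (Finset.range (k + 1)).filter Nat.Prime, p.Prime :=
    fun p hp => (Finset.mem_filter.1 hp).2
  obtain ⟨⟨hpos, hdep⟩, hleast⟩ := minModulusDiv_isLeast k
  refine le_antisymm (hleast ⟨Finset.prod_pos fun p hp => pow_pos (hmem p hp).pos _, ?_⟩)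
    (Nat.le_of_dvd hpos ?_)
  · refine dependsOnlyOnClass_divCond_of_forall fun p hp hpk => ?_
    refine DependsOnlyOnClass.of_dvd (aExp_isLeast hp k).1 ?_
    exact Finset.dvd_prod_of_mem (fun p => p ^ aExp p k)
      (Finset.mem_filter.2 ⟨Finset.mem_range.2 (Nat.lt_succ_of_le hpk), hp⟩)
  · refine Finset.prod_dvd_of_isRelPrime (fun p hp q hq hpq => ?_) fun p hp => ?_
    · exact Nat.coprime_iff_isRelPrime.1
        (((Nat.coprime_primes (hmem p hp) (hmem q hq)).2 hpq).pow _ _)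
    · exact ((hmem p hp).pow_dvd_iff_le_factorization hpos.ne').2
        (aExp_le_factorization (hmem p hp) hpos.ne' hdep)

theorem log_minModulusDiv (k : ℕ) : Real.log (minModulusDiv k : ℝ) = sumAExpLog k := by
  rw [minModulusDiv_eq_prod, sumAExpLog, Nat.cast_prod, Real.log_prod]
  · simp
  · intro p hp
    exact_mod_cast pow_ne_zero _ (Finset.mem_filter.1 hp).2.ne_zero

/-! ### Asymptotics -/

theorem log_factorial_le (k : ℕ) : Real.log (k.factorial : ℝ) ≤ k * Real.log k := by
  rw [← Real.log_pow]
  exact Real.log_le_log (by exact_mod_cast k.factorial_pos) (by exact_mod_cast k.factorial_le_pow)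

theorem mul_log_sub_le_log_factorial (k : ℕ) :
    k * Real.log k - k ≤ Real.log (k.factorial : ℝ) := by
  rcases Nat.eq_zero_or_pos k with rfl | hk
  · simp
  have hk' : (0 : ℝ) < k := by exact_mod_cast hk
  have hf : (0 : ℝ) < k.factorial := by exact_mod_cast k.factorial_pos
  -- `k ^ k / k!` is one term of the series of `exp k`.
  have h := Real.log_le_log (by positivity) (Real.pow_div_factorial_le_exp (k : ℝ) hk'.le k)
  rw [Real.log_exp, Real.log_div (by positivity) hf.ne', Real.log_pow] at h
  linarith

theorem isBigO_log_sub_mul_log {X : ℕ → ℕ} (hpos : ∀ k, 0 < X k)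
    (hle : ∀ k, X k ≤ k.factorial * k.lcmUpto)
    (hdvd : ∀ k, k.factorial ∣ X k * k.lcmUpto ^ 2) :
    (fun k : ℕ => Real.log (X k : ℝ) - (k : ℝ) * Real.log (k : ℝ))
      =O[atTop] (fun k : ℕ => (k : ℝ)) := by
  -- The `1` is the loss in `log k! ≥ k log k - k`; the rest bounds `2 ψ(k) / k` by Chebyshev.
  refine IsBigO.of_bound (1 + 2 * (Real.log 4 + 4)) (Eventually.of_forall fun k => ?_)
  have hX : (0 : ℝ) < X k := by exact_mod_cast hpos k
  have hL : (0 : ℝ) < k.lcmUpto := by exact_mod_cast k.lcmUpto_pos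
  have hf : (0 : ℝ) < k.factorial := by exact_mod_cast k.factorial_pos
  have hpsi : Real.log (k.lcmUpto : ℝ) ≤ (Real.log 4 + 4) * k := by
    rw [← Chebyshev.psi_eq_log_lcmUpto]
    exact Chebyshev.psi_le_const_mul_self k.cast_nonneg
  have hpsi0 : 0 ≤ Real.log (k.lcmUpto : ℝ) := Real.log_natCast_nonneg _
  have hup : Real.log (X k : ℝ) ≤ Real.log (k.factorial : ℝ) + Real.log (k.lcmUpto : ℝ) := by
    rw [← Real.log_mul hf.ne' hL.ne']
    exact Real.log_le_log hX (by exact_mod_cast hle k)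
  have hlow : Real.log (k.factorial : ℝ) ≤ Real.log (X k : ℝ) + 2 * Real.log (k.lcmUpto : ℝ) := by
    have h2 : 2 * Real.log (k.lcmUpto : ℝ) = Real.log ((k.lcmUpto : ℝ) ^ 2) := by
      rw [Real.log_pow]; norm_num
    rw [h2, ← Real.log_mul hX.ne' (by positivity)]
    refine Real.log_le_log hf ?_
    exact_mod_cast Nat.le_of_dvd (Nat.mul_pos (hpos k) (pow_pos k.lcmUpto_pos 2)) (hdvd k)
  have h1 := log_factorial_le k
  have h2 := mul_log_sub_le_log_factorial k
  have hk : (0 : ℝ) ≤ k := k.cast_nonneg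
  rw [Real.norm_eq_abs, Real.norm_eq_abs, abs_of_nonneg hk, abs_le]
  constructor <;> linarith

theorem mainTheorem3 :
    (∀ k : ℕ, Real.log (minModulusDiv k : ℝ) = sumAExpLog k) ∧
    (fun k : ℕ => Real.log (minModulusDiv k : ℝ) - (k : ℝ) * Real.log (k : ℝ))
      =O[atTop] (fun k : ℕ => (k : ℝ)) ∧
    (fun k : ℕ => sumAExpLog k - (k : ℝ) * Real.log (k : ℝ))
      =O[atTop] (fun k : ℕ => (k : ℝ)) ∧
    (fun k : ℕ => Real.log (minModulusAllDiv k : ℝ) - (k : ℝ) * Real.log (k : ℝ))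
      =O[atTop] (fun k : ℕ => (k : ℝ)) := by
  have hD := isBigO_log_sub_mul_log (fun k => (minModulusDiv_isLeast k).1.1) minModulusDiv_le
    factorial_dvd_minModulusDiv_mul
  refine ⟨log_minModulusDiv, hD, by simpa only [log_minModulusDiv] using hD, ?_⟩
  exact isBigO_log_sub_mul_log (fun k => (minModulusAllDiv_isLeast k).1.1) minModulusAllDiv_le
    factorial_dvd_minModulusAllDiv_mul
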